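/- Let $b>0$, and let $n$ bidders compete for $m$ items. The types $t_1,\dots,t_n\in[0,b]$ are independent, and $t_i$ has probability density $f_i$ on $[0,b]$ (the densities may differ across bidders). A feasible mechanism specifies measurable payments $pay_i(\mathbf t)$ and measurable allocation probabilities $q_i^j(\mathbf t)\ge 0$ (bidder $i$, item $j$) with $\sum_i q_i^j(\mathbf t)\le 1$ for every item $j$ and every type profile $\mathbf t\in[0,b]^n$. It implements the interim allocation rule consisting of measurable functions $q_i^j:[0,b]\to[0,1]$ if $q_i^j(t_i)=\mathbb E_{\mathbf t_{-i}}[q_i^j(t_i,\mathbf t_{-i})]$ for all $i$, $j$ and all $t_i\in[0,b]$. An interim allocation rule $(q_i^j)$ is implemented by some feasible mechanism if and only if, for all measurable virtual value functions $x_i^j:[0,b]\to[0,\infty)$ and every item $j$, $$\sum_{i=1}^n\int_0^b q_i^j(t)f_i(t)x_i^j(t)\,dt\;\le\;\int_0^{\infty}\Big[1-\prod_{i=1}^n\Big(1-\int_{\{t\in[0,b]:\,x_i^j(t)\ge v\}}f_i(t)\,dt\Big)\Big]dv ,$$ an inequality in $[0,\infty]$. This subsumes Border's theorem: for measurable sets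 $S_1,\dots,S_n\subseteq[0,b]$ and $x_i^j=\mathbf 1_{S_i}$ the inequality is equivalent to Border's inequality $$\sum_{i=1}^n\int_{S_i} q_i^j(t)f_i(t)\,dt\;\le\;1-\prod_{i=1}^n\Big(1-\int_{S_i}f_i(t)\,dt\Big),$$ and $(q_i^j)$ is implemented by some feasible mechanism if and only if Border's inequality holds for every item $j$ and all measurable $S_1,\dots,S_n\subseteq[0,b]$. -/

import Mathlib

namespace Auction

/-- `f` is a probability density on the type interval `[0, b]`.  (A nonzero Bochner integral is
only possible for an integrable `f`, so integrability is part of the last field.) -/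
structure IsTypeDensity (b : ℝ) (f : ℝ → ℝ) : Prop where
  measurable : Measurable f
  nonneg : ∀ t ∈ Set.Icc 0 b, 0 ≤ f t
  integral_eq_one : ∫ t in Set.Icc 0 b, f t = 1

/-- The law on `[0, b]` of a type with density `f`. -/
noncomputable def typeLaw (b : ℝ) (f : ℝ → ℝ) : MeasureTheory.Measure ℝ :=
  (MeasureTheory.volume.restrict (Set.Icc 0 b)).withDensity (fun t => ENNReal.ofReal (f t))

/-- A direct mechanism with `n` bidders and `m` items: at a profile `t` of reported types,
bidder `i` is allocated item `j` with probability `alloc j i t` and pays `pay i t`. -/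
structure DirectMechanism (m n : ℕ) where
  alloc : Fin m → Fin n → (Fin n → ℝ) → ℝ
  pay : Fin n → (Fin n → ℝ) → ℝ
  measurable_alloc : ∀ j i, Measurable (alloc j i)
  measurable_pay : ∀ i, Measurable (pay i)

variable {m n : ℕ}

/-- Ex post feasibility: at every type profile in `[0, b]^n`, allocation probabilities are
nonnegative and each item is allocated with total probability at most one. -/
def DirectMechanism.IsFeasible (M : DirectMechanism m n) (b : ℝ) : Prop :=
  ∀ t : Fin n → ℝ, (∀ i, t i ∈ Set.Icc 0 b) →
    ∀ j, (∀ i, 0 ≤ M.alloc j i t) ∧ ∑ i, M.alloc j i t ≤ 1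

/-- The interim allocation `E_{t_{-i}}[alloc j i (s, t_{-i})]` of item `j` to bidder `i` of type
`s`, the types being independent with densities `f k`.  The integrand does not depend on the
`i`-th coordinate of `t`, which is overwritten by `s`, so integrating over the law of the whole
profile is the same as integrating over `t_{-i}`. -/
noncomputable def DirectMechanism.interim (M : DirectMechanism m n) (b : ℝ)
    (f : Fin n → ℝ → ℝ) (j : Fin m) (i : Fin n) (s : ℝ) : ℝ :=
  ∫ t, M.alloc j i (Function.update t i s) ∂(MeasureTheory.Measure.pi fun k => typeLaw b (f k))

/-- An interim allocation rule: `q j i s` is the probability that bidder `i` gets item `j`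
when his type is `s ∈ [0, b]`. -/
structure IsInterimRule (b : ℝ) (q : Fin m → Fin n → ℝ → ℝ) : Prop where
  measurable : ∀ j i, Measurable (q j i)
  mem_Icc : ∀ j i, ∀ s ∈ Set.Icc 0 b, q j i s ∈ Set.Icc (0 : ℝ) 1

/-- `q` is the interim allocation rule of some feasible mechanism. -/
def Implementable (b : ℝ) (f : Fin n → ℝ → ℝ) (q : Fin m → Fin n → ℝ → ℝ) : Prop :=
  ∃ M : DirectMechanism m n, M.IsFeasible b ∧
    ∀ j i, ∀ s ∈ Set.Icc 0 b, q j i s = M.interim b f j i s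

/-- A virtual value function for one bidder: a measurable function `[0, b] → [0, ∞)`, possibly
unbounded. -/
structure IsVirtualValue (b : ℝ) (x : ℝ → ℝ) : Prop where
  measurable : Measurable x
  nonneg : ∀ t ∈ Set.Icc 0 b, 0 ≤ x t

/-- The virtual surplus inequality for one item,
`∑ i, ∫₀ᵇ qᵢ fᵢ xᵢ dt ≤ ∫₀^∞ (1 - ∏ i, (1 - ∫_{xᵢ(t) ≥ v} fᵢ(t) dt)) dv`.
Both sides are integrals of nonnegative functions, with values in `[0, ∞]`. -/
def SurplusInequality (b : ℝ) (f q x : Fin n → ℝ → ℝ) : Prop :=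
  ∑ i, ∫⁻ t in Set.Icc 0 b, ENNReal.ofReal (q i t * f i t * x i t) ≤
    ∫⁻ v in Set.Ioi (0 : ℝ),
      ENNReal.ofReal (1 - ∏ i, (1 - ∫ t in {t | t ∈ Set.Icc 0 b ∧ v ≤ x i t}, f i t))

/-- Border's inequality for one item and the sets of types `S i`. -/
def BorderInequality (f q : Fin n → ℝ → ℝ) (S : Fin n → Set ℝ) : Prop :=
  ∑ i, ∫ t in S i, q i t * f i t ≤ 1 - ∏ i, (1 - ∫ t in S i, f i t)

end Auction

/-! Necessity: a feasible mechanism allocates each item with total probability at most one, so its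
expected virtual surplus is at most the expected maximum of the `x i (t i)`. By the layer-cake
formula and independence, this maximum has expectation equal to the right-hand side
(`Implementable.lintegral_le`, `lintegral_sup_eq_lintegral_prod`). Indicators turn the surplus
inequality into Border's.

Sufficiency is proved from Border's inequalities, one item at a time. Integrating them over level
sets gives the surplus inequality for all values (`lintegral_le_of_borderInequality`). In L², the
interim rules of allocations form the image of a bounded closed convex set `Q` under the adjoint of
the map that views functions of single types as functions of profiles. If `q` lay outside the
closure of that image, Hahn–Banach would give values `x` strictly separating it. But giving the item
to the highest positive value attains the expected maximum of the positive parts, which dominates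
the pairing of `x` with `q`. A nested-sets argument, in place of weak compactness, shows that `q` is
attained (`exists_forall_inner_eq_of_forall_exists_le`). This yields the interim rule almost
everywhere; a change on a null set of profiles makes it exact at every type
(`exists_allocation_of_ae_eq`). -/

open MeasureTheory Filter Topology
open scoped ENNReal NNReal

namespace Auction

/-! ### Separation and attainment in Hilbert space -/

section Hilbert

variable {E F : Type*} [NormedAddCommGroup E] [InnerProductSpace ℝ E] [CompleteSpace E]
  [NormedAddCommGroup F] [InnerProductSpace ℝ F] [CompleteSpace F]

/-- A decreasing sequence of nonempty, uniformly bounded closed convex sets in a Hilbert space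
has a common point. -/
theorem exists_mem_of_antitone_closed_convex {A : ℕ → Set E} (hA : Antitone A)
    (hne : ∀ k, (A k).Nonempty) (hcl : ∀ k, IsClosed (A k)) (hconv : ∀ k, Convex ℝ (A k))
    {R : ℝ} (hR : ∀ k, ∀ x ∈ A k, ‖x‖ ≤ R) : ∃ x, ∀ k, x ∈ A k := by
  -- Take the point of least norm in each set. The obtuse-angle condition there bounds squared
  -- distances by increments of the squared norm, which is monotone and bounded, so these points
  -- form a Cauchy sequence.
  have key : ∀ k, ∃ v ∈ A k, ∀ w ∈ A k, inner ℝ (0 - v) (w - v) ≤ 0 := by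
    intro k
    obtain ⟨v, hv, h⟩ :=
      exists_norm_eq_iInf_of_complete_convex (hne k) (hcl k).isComplete (hconv k) 0
    exact ⟨v, hv, (norm_eq_iInf_iff_real_inner_le_zero (hconv k) hv).1 h⟩
  choose a ha hmin using key
  have hdist : ∀ k l, k ≤ l → ‖a l - a k‖ ^ 2 ≤ ‖a l‖ ^ 2 - ‖a k‖ ^ 2 := by
    intro k l hkl
    have h := hmin k (a l) (hA hkl (ha l))
    have e : ‖a l‖ ^ 2 = ‖a l - a k‖ ^ 2 + 2 * inner ℝ (a l - a k) (a k) + ‖a k‖ ^ 2 := by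
      rw [← norm_add_sq_real, sub_add_cancel]
    rw [zero_sub, inner_neg_left, real_inner_comm] at h
    linarith
  have hmono : Monotone fun k => ‖a k‖ ^ 2 := fun k l hkl => by
    have := hdist k l hkl
    have := sq_nonneg ‖a l - a k‖
    show ‖a k‖ ^ 2 ≤ ‖a l‖ ^ 2
    linarith
  have hbdd : BddAbove (Set.range fun k => ‖a k‖ ^ 2) := by
    refine ⟨R ^ 2, ?_⟩
    rintro _ ⟨k, rfl⟩
    exact pow_le_pow_left₀ (norm_nonneg _) (hR k _ (ha k)) 2
  have hlim := (tendsto_atTop_ciSup hmono hbdd).cauchySeq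
  have hcauchy : CauchySeq a := by
    rw [Metric.cauchySeq_iff'] at hlim ⊢
    intro ε hε
    obtain ⟨N, hN⟩ := hlim (ε ^ 2) (by positivity)
    refine ⟨N, fun l hl => ?_⟩
    have h1 := hN l hl
    rw [Real.dist_eq] at h1
    rw [dist_eq_norm]
    exact lt_of_pow_lt_pow_left₀ 2 hε.le
      ((hdist N l hl).trans_lt ((le_abs_self _).trans_lt h1))
  obtain ⟨x, hx⟩ := cauchySeq_tendsto_of_complete hcauchy
  exact ⟨x, fun k => (hcl k).mem_of_tendsto hx
    (eventually_atTop.2 ⟨k, fun l hl => hA hl (ha l)⟩)⟩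

/-- If the support function of a bounded closed convex set `Q`, pulled back along `J`, dominates
the functional `⟪·, p⟫`, then this functional is represented by a point of `Q`. -/
theorem exists_forall_inner_eq_of_forall_exists_le (J : F →L[ℝ] E) {Q : Set E}
    (hcl : IsClosed Q) (hconv : Convex ℝ Q) {R : ℝ} (hR : ∀ y ∈ Q, ‖y‖ ≤ R) (p : F)
    (h : ∀ x : F, ∃ y ∈ Q, inner ℝ x p ≤ inner ℝ (J x) y) :
    ∃ y ∈ Q, ∀ x : F, inner ℝ (J x) y = inner ℝ x p := by
  set T := ContinuousLinearMap.adjoint J with hT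
  have hTJ : ∀ x y, inner ℝ x (T y) = inner ℝ (J x) y := fun x y =>
    ContinuousLinearMap.adjoint_inner_right J x y
  have hp : p ∈ closure (T '' Q) := by
    by_contra hp
    obtain ⟨φ, u, hφ, hu⟩ := geometric_hahn_banach_closed_point
      ((hconv.linear_image T.toLinearMap).closure) isClosed_closure hp
    obtain ⟨y, hy, hle⟩ := h ((InnerProductSpace.toDual ℝ F).symm φ)
    have h1 := hφ (T y) (subset_closure ⟨y, hy, rfl⟩)
    rw [← hTJ, InnerProductSpace.toDual_symm_apply, InnerProductSpace.toDual_symm_apply] at hle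
    linarith
  -- The image `T '' Q` is not known to be closed. The points of `Q` sent within `1 / (k + 1)` of
  -- `p` form nested closed convex sets, and a common point is sent exactly to `p`.
  obtain ⟨y, hy⟩ := exists_mem_of_antitone_closed_convex
    (A := fun k : ℕ => Q ∩ T ⁻¹' Metric.closedBall p (1 / ((k : ℝ) + 1)))
    (fun k l hkl => Set.inter_subset_inter_right _ (Set.preimage_mono
      (Metric.closedBall_subset_closedBall (Nat.one_div_le_one_div hkl))))
    (fun k => by
      obtain ⟨_, ⟨y, hy, rfl⟩, hd⟩ := Metric.mem_closure_iff.1 hp (1 / ((k : ℝ) + 1))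
        Nat.one_div_pos_of_nat
      exact ⟨y, hy, by rw [Set.mem_preimage, Metric.mem_closedBall, dist_comm]; exact hd.le⟩)
    (fun k => hcl.inter (Metric.isClosed_closedBall.preimage T.continuous))
    (fun k => hconv.inter ((convex_closedBall _ _).linear_preimage T.toLinearMap))
    (fun k y hy => hR y hy.1)
  have hTy : T y = p := by
    refine eq_of_dist_eq_zero (le_antisymm ?_ dist_nonneg)
    exact ge_of_tendsto' (tendsto_one_div_add_atTop_nhds_zero_nat (𝕜 := ℝ)) fun k => (hy k).2
  exact ⟨y, (hy 0).1, fun x => by rw [← hTJ, hTy]⟩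

end Hilbert

/-! ### Independent type profiles and the law of the maximum -/

section Profiles

variable {n : ℕ} (μ : Fin n → Measure ℝ) [∀ i, IsProbabilityMeasure (μ i)]

theorem measurable_update_pair (i : Fin n) :
    Measurable fun p : ℝ × (Fin n → ℝ) => Function.update p.2 i p.1 := by
  refine measurable_pi_iff.2 fun k => ?_
  rcases eq_or_ne k i with rfl | hk
  · simpa using measurable_fst
  · simp only [Function.update_of_ne hk]
    exact (measurable_pi_apply k).comp measurable_snd

/-- Redrawing one coordinate of a random profile does not change its law. -/
theorem measurePreserving_update (i : Fin n) :
    MeasurePreserving (fun p : ℝ × (Fin n → ℝ) => Function.update p.2 i p.1)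
      ((μ i).prod (Measure.pi μ)) (Measure.pi μ) := by
  refine ⟨measurable_update_pair i, (Measure.pi_eq fun s hs => ?_).symm⟩
  rw [Measure.map_apply (measurable_update_pair i) (MeasurableSet.univ_pi hs)]
  -- The old `i`-th coordinate is discarded, so that side of the box becomes `Set.univ`, of mass
  -- one.
  have : (fun p : ℝ × (Fin n → ℝ) => Function.update p.2 i p.1) ⁻¹' Set.univ.pi s =
      s i ×ˢ Set.univ.pi (Function.update s i Set.univ) := by
    ext p
    simp only [Set.mem_preimage, Set.mem_univ_pi, Set.mem_prod]
    constructor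
    · refine fun h => ⟨by simpa using h i, fun k => ?_⟩
      rcases eq_or_ne k i with rfl | hk
      · simp
      · simpa [hk] using h k
    · rintro ⟨h1, h2⟩ k
      rcases eq_or_ne k i with rfl | hk
      · simpa using h1
      · simpa [hk] using h2 k
  rw [this, Measure.prod_prod, Measure.pi_pi, ← Finset.mul_prod_erase _ _ (Finset.mem_univ i),
    ← Finset.mul_prod_erase _ (fun k => μ k (s k)) (Finset.mem_univ i)]
  simp only [Function.update_self, measure_univ, one_mul]
  congr 1
  refine Finset.prod_congr rfl fun k hk => ?_
  rw [Function.update_of_ne (Finset.ne_of_mem_erase hk)]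

theorem lintegral_pi_eq_lintegral_update (i : Fin n) {g : (Fin n → ℝ) → ℝ≥0∞}
    (hg : Measurable g) :
    ∫⁻ t, g t ∂Measure.pi μ =
      ∫⁻ s, ∫⁻ t, g (Function.update t i s) ∂Measure.pi μ ∂μ i := by
  rw [← (measurePreserving_update μ i).lintegral_comp hg]
  exact lintegral_prod _ (hg.comp (measurable_update_pair i)).aemeasurable

/-- The tower property: condition on the type of bidder `i`, in the overwriting form used by
`DirectMechanism.interim`. -/
theorem integral_pi_eq_integral_update (i : Fin n) {g : (Fin n → ℝ) → ℝ}
    (hg : Integrable g (Measure.pi μ)) :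
    ∫ t, g t ∂Measure.pi μ =
      ∫ s, ∫ t, g (Function.update t i s) ∂Measure.pi μ ∂μ i := by
  have hmp := measurePreserving_update μ i
  have h1 := integral_map hmp.measurable.aemeasurable
    (f := g) (by rw [hmp.map_eq]; exact hg.aestronglyMeasurable)
  rw [hmp.map_eq] at h1
  rw [h1]
  exact integral_prod _ (hmp.integrable_comp_of_integrable hg)

/-- The expected highest virtual value, computed from the laws of the individual types. -/
theorem lintegral_sup_eq_lintegral_prod {x : Fin n → ℝ → ℝ≥0} (hx : ∀ i, Measurable (x i)) :
    ∫⁻ t, ((Finset.univ.sup fun i => x i (t i) : ℝ≥0) : ℝ≥0∞) ∂Measure.pi μ =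
      ∫⁻ v in Set.Ioi (0 : ℝ),
        ENNReal.ofReal (1 - ∏ i, (1 - (μ i {s | v ≤ x i s}).toReal)) := by
  have hmeas : Measurable fun t : Fin n → ℝ => (Finset.univ.sup fun i => x i (t i) : ℝ≥0) := by
    simp only [Finset.sup_univ_eq_ciSup]
    exact Measurable.iSup fun i => (hx i).comp (measurable_pi_apply i)
  have h := lintegral_eq_lintegral_meas_le (Measure.pi μ)
    (f := fun t : Fin n → ℝ => ((Finset.univ.sup fun i => x i (t i) : ℝ≥0) : ℝ))
    (Eventually.of_forall fun t => NNReal.coe_nonneg _) hmeas.coe_nnreal_real.aemeasurable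
  simp only [ENNReal.ofReal_coe_nnreal] at h
  rw [h]
  refine setLIntegral_congr_fun measurableSet_Ioi fun v hv => ?_
  have hv : (0 : ℝ) < v := hv
  have hms : ∀ i, MeasurableSet {s | v ≤ (x i s : ℝ)} := fun i =>
    measurableSet_le measurable_const (hx i).coe_nnreal_real
  -- The maximum is below `v` exactly when every value is. Positivity of `v` is needed because the
  -- empty supremum is `0`.
  have hset : {t : Fin n → ℝ | v ≤ ((Finset.univ.sup fun i => x i (t i) : ℝ≥0) : ℝ)} =
      (Set.univ.pi fun i => {s | v ≤ (x i s : ℝ)}ᶜ)ᶜ := by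
    ext t
    lift v to ℝ≥0 using hv.le
    rw [← not_iff_not]
    simp only [Set.mem_ofPred_eq, not_le, Set.mem_compl_iff, not_not, Set.mem_univ_pi,
      NNReal.coe_lt_coe]
    rw [Finset.sup_lt_iff (by simpa using hv)]
    simp
  show Measure.pi μ _ = _
  rw [hset, prob_compl_eq_one_sub (MeasurableSet.univ_pi fun i => (hms i).compl), Measure.pi_pi]
  rw [ENNReal.ofReal_sub _ (Finset.prod_nonneg fun i _ => ?_), ENNReal.ofReal_one,
    ENNReal.ofReal_prod_of_nonneg (fun i _ => ?_)]
  · congr 1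
    refine Finset.prod_congr rfl fun i _ => ?_
    rw [prob_compl_eq_one_sub (hms i), ENNReal.ofReal_sub _ ENNReal.toReal_nonneg,
      ENNReal.ofReal_one, ENNReal.ofReal_toReal (measure_ne_top _ _)]
  all_goals
    rw [sub_nonneg]
    exact ENNReal.toReal_le_of_le_ofReal zero_le_one (by simpa using prob_le_one)

end Profiles

/-! ### The efficient allocation -/

section Winner

variable {n : ℕ}

/-- The allocation that gives the item to the bidder with the highest value, if it is positive;
ties are broken in favour of the smallest index. -/
noncomputable def winner (y : Fin n → ℝ≥0) (i : Fin n) : ℝ :=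
  open Classical in if 0 < y i ∧ (∀ k, y k ≤ y i) ∧ ∀ k < i, y k < y i then 1 else 0

theorem winner_nonneg (y : Fin n → ℝ≥0) (i : Fin n) : 0 ≤ winner y i := by
  unfold winner; split_ifs <;> simp

theorem winner_le_one (y : Fin n → ℝ≥0) (i : Fin n) : winner y i ≤ 1 := by
  unfold winner; split_ifs <;> simp

/-- Two winners would both be maximal, and the one with the larger index would have to beat the
other strictly. -/
theorem winner_eq_zero_of_ne {y : Fin n → ℝ≥0} {i k : Fin n} (hi : winner y i ≠ 0)
    (hk : k ≠ i) : winner y k = 0 := by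
  unfold winner at hi ⊢
  rw [if_neg]
  rintro ⟨-, h1, h2⟩
  simp only [ne_eq, ite_eq_right_iff, one_ne_zero, imp_false, not_not] at hi
  obtain ⟨-, h3, h4⟩ := hi
  rcases lt_or_gt_of_ne hk with h | h
  · exact absurd (h4 k h) (not_lt.2 (h1 i))
  · exact absurd (h2 i h) (not_lt.2 (h3 k))

theorem sum_winner_le_one (y : Fin n → ℝ≥0) : ∑ i, winner y i ≤ 1 := by
  by_cases h : ∃ i, winner y i ≠ 0
  · obtain ⟨i, hi⟩ := h
    rw [Finset.sum_eq_single i (fun k _ hk => winner_eq_zero_of_ne hi hk) (by simp)]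
    exact winner_le_one y i
  · push Not at h
    simp [h]

/-- A winner carries the maximum. If nobody wins, the maximum is `0`, since otherwise its maximiser
of least index would win. -/
theorem sum_mul_winner (y : Fin n → ℝ≥0) :
    ∑ i, (y i : ℝ) * winner y i = ((Finset.univ.sup y : ℝ≥0) : ℝ) := by
  by_cases h : ∃ i, winner y i ≠ 0
  · obtain ⟨i, hi⟩ := h
    rw [Finset.sum_eq_single i
      (fun k _ hk => by rw [winner_eq_zero_of_ne hi hk, mul_zero]) (by simp)]
    have h1 : 0 < y i ∧ (∀ k, y k ≤ y i) ∧ ∀ k < i, y k < y i := by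
      by_contra h
      exact hi (by unfold winner; rw [if_neg h])
    have h2 : winner y i = 1 := by unfold winner; rw [if_pos h1]
    rw [h2, mul_one, NNReal.coe_inj]
    exact le_antisymm (Finset.le_sup (Finset.mem_univ i)) (Finset.sup_le fun k _ => h1.2.1 k)
  · push Not at h
    simp only [h, mul_zero, Finset.sum_const_zero]
    symm
    rw [NNReal.coe_eq_zero]
    by_contra hne
    have hpos : 0 < Finset.univ.sup y := pos_iff_ne_zero.2 hne
    have hnonempty : (Finset.univ : Finset (Fin n)).Nonempty := by
      rw [Finset.nonempty_iff_ne_empty]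
      intro he
      rw [he, Finset.sup_empty] at hpos
      exact lt_irrefl _ hpos
    obtain ⟨k, -, hk⟩ := Finset.exists_mem_eq_sup _ hnonempty y
    have hS : (Finset.univ.filter fun i => y i = Finset.univ.sup y).Nonempty :=
      ⟨k, by simp [hk]⟩
    set i := Finset.min' _ hS
    have hi : y i = Finset.univ.sup y := (Finset.mem_filter.1 (Finset.min'_mem _ hS)).2
    have hle : ∀ l, y l ≤ y i := fun l => by rw [hi]; exact Finset.le_sup (Finset.mem_univ l)
    have hlt : ∀ l < i, y l < y i := fun l hl => lt_of_le_of_ne (hle l) fun he =>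
      absurd (Finset.min'_le _ l (by simp [he, hi])) (not_le.2 hl)
    have h1 := h i
    unfold winner at h1
    rw [if_pos ⟨by rw [hi]; exact hpos, hle, hlt⟩] at h1
    exact one_ne_zero h1

theorem measurable_winner (i : Fin n) : Measurable fun y : Fin n → ℝ≥0 => winner y i := by
  unfold winner
  have hm : ∀ k, Measurable fun y : Fin n → ℝ≥0 => y k := measurable_pi_apply
  have h : {y : Fin n → ℝ≥0 | 0 < y i ∧ (∀ k, y k ≤ y i) ∧ ∀ k < i, y k < y i} =
      {y | 0 < y i} ∩ ((⋂ k, {y | y k ≤ y i}) ∩ ⋂ k, ⋂ _ : k < i, {y | y k < y i}) := by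
    ext; simp
  refine Measurable.ite ?_ measurable_const measurable_const
  rw [h]
  exact (measurableSet_lt measurable_const (hm i)).inter
    ((MeasurableSet.iInter fun k => measurableSet_le (hm k) (hm i)).inter
      (MeasurableSet.iInter fun k => MeasurableSet.iInter fun _ => measurableSet_lt (hm k) (hm i)))

end Winner

/-! ### The convex set of allocations in L² -/

section Allocations

theorem coeFn_sum_Lp {α ι : Type*} {mα : MeasurableSpace α} {P : Measure α} (s : Finset ι)
    (y : ι → Lp ℝ 2 P) : ⇑(∑ i ∈ s, y i) =ᵐ[P] fun t => ∑ i ∈ s, y i t := by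
  classical
  induction s using Finset.induction_on with
  | empty => exact Lp.coeFn_zero ℝ 2 P
  | insert i s hi ih =>
    rw [Finset.sum_insert hi]
    filter_upwards [Lp.coeFn_add (y i) (∑ i ∈ s, y i), ih] with t h1 h2
    rw [h1, Finset.sum_insert hi, Pi.add_apply, h2]

variable {n : ℕ} {α : Type*} [MeasurableSpace α] (P : Measure α)

/-- The square-integrable random allocations of one item. -/
def allocationSet (n : ℕ) : Set (PiLp 2 fun _ : Fin n => Lp ℝ 2 P) :=
  {y | ∀ᵐ t ∂P, (∀ i, 0 ≤ y i t) ∧ ∑ i, y i t ≤ 1}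

/-- The constraints are inequalities in the order of L², and that order is closed. -/
theorem isClosed_allocationSet [IsProbabilityMeasure P] : IsClosed (allocationSet P n) := by
  have : allocationSet P n =
      (⋂ i, {y | 0 ≤ y i}) ∩ {y | ∑ i, y i ≤ Lp.const 2 P (1 : ℝ)} := by
    ext y
    simp only [allocationSet, Set.mem_ofPred_eq, eventually_and, Set.mem_inter_iff, Set.mem_iInter,
      eventually_all]
    refine and_congr (forall_congr' fun i => Lp.coeFn_nonneg (y i)) ?_
    rw [← Lp.coeFn_le]
    refine eventually_congr ?_
    filter_upwards [coeFn_sum_Lp Finset.univ fun i => y i, Lp.coeFn_const 2 P (1 : ℝ)]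
      with t h1 h2
    rw [h1, h2, Function.const_apply]
  rw [this]
  refine IsClosed.inter (isClosed_iInter fun i => ?_) ?_
  · exact isClosed_le continuous_const (PiLp.continuous_apply 2 _ i)
  · exact isClosed_le (continuous_finsetSum _ fun i _ => PiLp.continuous_apply 2 _ i)
      continuous_const

theorem convex_allocationSet : Convex ℝ (allocationSet P n) := by
  intro y hy z hz a b ha hb hab
  have h : ∀ i, ∀ᵐ t ∂P, (a • y + b • z) i t = a * y i t + b * z i t := by
    intro i
    filter_upwards [Lp.coeFn_add (a • y i) (b • z i), Lp.coeFn_smul a (y i),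
      Lp.coeFn_smul b (z i)] with t h1 h2 h3
    rw [PiLp.add_apply, PiLp.smul_apply, PiLp.smul_apply, h1, Pi.add_apply, h2, h3]
    rfl
  filter_upwards [hy, hz, eventually_all.2 h] with t hy hz h
  simp only [h]
  refine ⟨fun i => add_nonneg (mul_nonneg ha (hy.1 i)) (mul_nonneg hb (hz.1 i)), ?_⟩
  rw [Finset.sum_add_distrib, ← Finset.mul_sum, ← Finset.mul_sum]
  nlinarith [hy.2, hz.2]

theorem norm_le_of_mem_allocationSet [IsProbabilityMeasure P] :
    ∀ y ∈ allocationSet P n, ‖y‖ ≤ √n := by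
  intro y hy
  rw [PiLp.norm_eq_of_L2]
  refine Real.sqrt_le_sqrt ?_
  have h : ∀ i, ‖y i‖ ^ 2 ≤ 1 := by
    intro i
    refine pow_le_one₀ (norm_nonneg _) ?_
    refine (Lp.norm_le_of_ae_bound zero_le_one (C := 1) ?_).trans ?_
    · filter_upwards [hy] with t ht
      rw [Real.norm_of_nonneg (ht.1 i)]
      exact (Finset.single_le_sum (fun k _ => ht.1 k) (Finset.mem_univ i)).trans ht.2
    · simp [measureUnivNNReal]
  exact (Finset.sum_le_sum fun i _ => h i).trans (by simp)

end Allocations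

/-! ### From functions of types to functions of profiles -/

section Lift

variable {n : ℕ} (μ : Fin n → Measure ℝ) [∀ i, IsProbabilityMeasure (μ i)]

/-- Functions of the individual types, seen as functions of the type profile. -/
noncomputable def liftProfile :
    (PiLp 2 fun i => Lp ℝ 2 (μ i)) →L[ℝ] PiLp 2 fun _ : Fin n => Lp ℝ 2 (Measure.pi μ) :=
  (PiLp.continuousLinearEquiv 2 ℝ fun _ : Fin n => Lp ℝ 2 (Measure.pi μ)).symm.toContinuousLinearMap
    ∘L ContinuousLinearMap.pi fun i =>
      (Lp.compMeasurePreservingₗᵢ ℝ (Function.eval i)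
        (measurePreserving_eval μ i)).toContinuousLinearMap ∘L PiLp.proj 2 _ i

theorem liftProfile_apply (x : PiLp 2 fun i => Lp ℝ 2 (μ i)) (i : Fin n) :
    liftProfile μ x i =
      Lp.compMeasurePreserving (Function.eval i) (measurePreserving_eval μ i) (x i) := rfl

theorem coeFn_liftProfile (x : PiLp 2 fun i => Lp ℝ 2 (μ i)) (i : Fin n) :
    liftProfile μ x i =ᵐ[Measure.pi μ] fun t => x i (t i) := by
  rw [liftProfile_apply]
  exact Lp.coeFn_compMeasurePreserving _ _

theorem integrable_mul_of_liftProfile (x : PiLp 2 fun i => Lp ℝ 2 (μ i))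
    (y : PiLp 2 fun _ : Fin n => Lp ℝ 2 (Measure.pi μ)) (i : Fin n) :
    Integrable (fun t => x i (t i) * y i t) (Measure.pi μ) := by
  refine (L2.integrable_inner (𝕜 := ℝ) (liftProfile μ x i) (y i)).congr ?_
  filter_upwards [coeFn_liftProfile μ x i] with t ht
  rw [ht, Real.inner_apply]

theorem inner_liftProfile (x : PiLp 2 fun i => Lp ℝ 2 (μ i))
    (y : PiLp 2 fun _ : Fin n => Lp ℝ 2 (Measure.pi μ)) :
    inner ℝ (liftProfile μ x) y = ∑ i, ∫ t, x i (t i) * y i t ∂Measure.pi μ := by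
  rw [PiLp.inner_apply]
  refine Finset.sum_congr rfl fun i _ => ?_
  rw [L2.inner_def]
  refine integral_congr_ae ?_
  filter_upwards [coeFn_liftProfile μ x i] with t ht
  rw [ht, Real.inner_apply]

end Lift

/-! ### Existence of an allocation with the prescribed interim rule -/

section Existence

variable {n : ℕ} (μ : Fin n → Measure ℝ) [∀ i, IsProbabilityMeasure (μ i)]

theorem memLp_of_measurable_of_mem_Icc {α : Type*} [MeasurableSpace α] {P : Measure α}
    [IsFiniteMeasure P] {g : α → ℝ} (hg : Measurable g) (h01 : ∀ᵐ t ∂P, g t ∈ Set.Icc (0 : ℝ) 1)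
    (r : ℝ≥0∞) : MemLp g r P :=
  MemLp.of_bound hg.aestronglyMeasurable 1 (h01.mono fun t ht => by
    rw [Real.norm_of_nonneg ht.1]; exact ht.2)

/-- The efficient allocation for the positive parts of square-integrable values `x` attains the
expected highest value. -/
theorem exists_mem_allocationSet_inner_eq (x : PiLp 2 fun i => Lp ℝ 2 (μ i)) :
    ∃ y ∈ allocationSet (Measure.pi μ) n, 0 ≤ inner ℝ (liftProfile μ x) y ∧
      ENNReal.ofReal (inner ℝ (liftProfile μ x) y) =
        ∫⁻ t, ((Finset.univ.sup fun i => (x i (t i)).toNNReal : ℝ≥0) : ℝ≥0∞) ∂Measure.pi μ := by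
  set P := Measure.pi μ
  set w : Fin n → (Fin n → ℝ) → ℝ := fun i t => winner (fun k => (x k (t k)).toNNReal) i
  have hwm : ∀ i, Measurable (w i) := fun i => (measurable_winner i).comp <|
    measurable_pi_iff.2 fun k =>
      ((Lp.stronglyMeasurable (x k)).measurable.comp (measurable_pi_apply k)).real_toNNReal
  have hw : ∀ i, MemLp (w i) 2 P := fun i => memLp_of_measurable_of_mem_Icc (hwm i)
    (Eventually.of_forall fun t => ⟨winner_nonneg _ _, winner_le_one _ _⟩) 2
  set y : PiLp 2 fun _ : Fin n => Lp ℝ 2 P := WithLp.toLp 2 fun i => (hw i).toLp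
  have hy : ∀ i, y i =ᵐ[P] w i := fun i => (hw i).coeFn_toLp
  have hsum : ∀ᵐ t ∂P, ∑ i, x i (t i) * y i t =
      ((Finset.univ.sup fun i => (x i (t i)).toNNReal : ℝ≥0) : ℝ) := by
    filter_upwards [eventually_all.2 hy] with t ht
    rw [← sum_mul_winner]
    refine Finset.sum_congr rfl fun i _ => ?_
    rw [ht i]
    show _ = _ * w i t
    -- A bidder with nonpositive value never wins, so truncating the values at zero leaves the
    -- surplus unchanged.
    rcases le_or_gt (x i (t i)) 0 with h | h
    · have : w i t = 0 := by
        simp only [w, winner]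
        rw [if_neg]
        rintro ⟨h1, -⟩
        simp [Real.toNNReal_of_nonpos h] at h1
      rw [this, mul_zero, mul_zero]
    · rw [Real.coe_toNNReal _ h.le]
  have hI : inner ℝ (liftProfile μ x) y = ∫ t, ∑ i, x i (t i) * y i t ∂P := by
    rw [inner_liftProfile, integral_finsetSum _
      fun i _ => integrable_mul_of_liftProfile μ x y i]
  have hnn : 0 ≤ᵐ[P] fun t => ∑ i, x i (t i) * y i t := by
    filter_upwards [hsum] with t ht
    rw [ht]
    exact NNReal.coe_nonneg _
  refine ⟨y, ?_, ?_, ?_⟩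
  · filter_upwards [eventually_all.2 hy] with t ht
    simp only [ht]
    exact ⟨fun i => winner_nonneg _ _, sum_winner_le_one _⟩
  · rw [hI]
    exact integral_nonneg_of_ae hnn
  · rw [hI, ofReal_integral_eq_lintegral_ofReal
      (integrable_finsetSum _ fun i _ => integrable_mul_of_liftProfile μ x y i) hnn]
    refine lintegral_congr_ae ?_
    filter_upwards [hsum] with t ht
    rw [ht, ENNReal.ofReal_coe_nnreal]

theorem ofReal_integral_le_lintegral {α : Type*} [MeasurableSpace α] {P : Measure α} {g : α → ℝ}
    (hg : Integrable g P) : ENNReal.ofReal (∫ t, g t ∂P) ≤ ∫⁻ t, ENNReal.ofReal (g t) ∂P := by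
  refine (ENNReal.ofReal_le_ofReal
    (integral_mono hg hg.pos_part fun t => le_max_left _ _)).trans ?_
  rw [ofReal_integral_eq_lintegral_ofReal hg.pos_part
    (Eventually.of_forall fun t => le_max_right _ _)]
  refine lintegral_mono fun t => ?_
  rcases le_total (g t) 0 with h | h
  · simp [h]
  · simp [h]

/-- A random allocation of one item may be taken to be measurable and feasible at every profile. -/
theorem exists_measurable_of_mem_allocationSet {α : Type*} [MeasurableSpace α] {P : Measure α}
    {y : PiLp 2 fun _ : Fin n => Lp ℝ 2 P} (hy : y ∈ allocationSet P n) :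
    ∃ a : Fin n → α → ℝ, (∀ i, Measurable (a i)) ∧ (∀ i t, 0 ≤ a i t) ∧
      (∀ t, ∑ i, a i t ≤ 1) ∧ ∀ i, y i =ᵐ[P] a i := by
  have hym : ∀ i, Measurable (y i) := fun i => (Lp.stronglyMeasurable (y i)).measurable
  set G : Set α := {t | (∀ i, 0 ≤ y i t) ∧ ∑ i, y i t ≤ 1}
  have hG : MeasurableSet G := by
    have : G = (⋂ i, {t | 0 ≤ y i t}) ∩ {t | ∑ i, y i t ≤ 1} := by ext; simp [G]
    rw [this]
    exact (MeasurableSet.iInter fun i => measurableSet_le measurable_const (hym i)).inter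
      (measurableSet_le (Finset.measurable_sum _ fun i _ => hym i) measurable_const)
  -- Off the set where the representatives are feasible, nobody receives the item.
  refine ⟨fun i => G.indicator (y i), fun i => (hym i).indicator hG, fun i t => ?_, fun t => ?_,
    fun i => ?_⟩
  · exact Set.indicator_nonneg (fun t ht => ht.1 i) t
  · by_cases ht : t ∈ G
    · simpa [ht] using ht.2
    · simp [ht]
  · filter_upwards [hy] with t ht
    exact (Set.indicator_of_mem (s := G) ht _).symm

/-- An interim rule for one item satisfying the surplus inequality is, almost everywhere, the
interim rule of an allocation. -/
theorem exists_allocation_of_surplus {q : Fin n → ℝ → ℝ} (hqm : ∀ i, Measurable (q i))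
    (hq : ∀ i, ∀ᵐ s ∂μ i, q i s ∈ Set.Icc (0 : ℝ) 1)
    (h : ∀ x : Fin n → ℝ → ℝ≥0, (∀ i, Measurable (x i)) →
      ∑ i, ∫⁻ s, ENNReal.ofReal (q i s) * x i s ∂μ i ≤
        ∫⁻ t, ((Finset.univ.sup fun i => x i (t i) : ℝ≥0) : ℝ≥0∞) ∂Measure.pi μ) :
    ∃ a : Fin n → (Fin n → ℝ) → ℝ, (∀ i, Measurable (a i)) ∧ (∀ i t, 0 ≤ a i t) ∧
      (∀ t, ∑ i, a i t ≤ 1) ∧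
      ∀ i, ∀ᵐ s ∂μ i, q i s = ∫ t, a i (Function.update t i s) ∂Measure.pi μ := by
  set P := Measure.pi μ
  have hqL : ∀ i, MemLp (q i) 2 (μ i) := fun i => memLp_of_measurable_of_mem_Icc (hqm i) (hq i) 2
  have hqI : ∀ i, Integrable (q i) (μ i) := fun i =>
    memLp_one_iff_integrable.1 (memLp_of_measurable_of_mem_Icc (hqm i) (hq i) 1)
  set p : PiLp 2 fun i => Lp ℝ 2 (μ i) := WithLp.toLp 2 fun i => (hqL i).toLp
  have hpq : ∀ i, p i =ᵐ[μ i] q i := fun i => (hqL i).coeFn_toLp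
  have hxp : ∀ x : PiLp 2 fun i => Lp ℝ 2 (μ i), ∀ i,
      (fun s => inner ℝ (x i s) (p i s)) =ᵐ[μ i] fun s => x i s * q i s := by
    intro x i
    filter_upwards [hpq i] with s hs
    rw [hs, Real.inner_apply]
  have hinner : ∀ x : PiLp 2 fun i => Lp ℝ 2 (μ i),
      inner ℝ x p = ∑ i, ∫ s, x i s * q i s ∂μ i := by
    intro x
    rw [PiLp.inner_apply]
    refine Finset.sum_congr rfl fun i _ => ?_
    rw [L2.inner_def, integral_congr_ae (hxp x i)]
  obtain ⟨y, hyQ, hy⟩ := exists_forall_inner_eq_of_forall_exists_le (liftProfile μ)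
    (isClosed_allocationSet (n := n) P) (convex_allocationSet P)
    (norm_le_of_mem_allocationSet P) p (by
      intro x
      obtain ⟨y, hyQ, hy0, hy⟩ := exists_mem_allocationSet_inner_eq μ x
      refine ⟨y, hyQ, (ENNReal.ofReal_le_ofReal_iff hy0).1 ?_⟩
      rw [hy, hinner]
      -- The test functions `x` are signed, while `h` concerns nonnegative values. Passing to
      -- positive parts only increases the pairing with `q`, since `q` is nonnegative.
      refine le_trans ?_ (h (fun i s => (x i s).toNNReal) fun i =>
        (Lp.stronglyMeasurable (x i)).measurable.real_toNNReal)
      have hsub : ENNReal.ofReal (∑ i, ∫ s, x i s * q i s ∂μ i) ≤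
          ∑ i, ENNReal.ofReal (∫ s, x i s * q i s ∂μ i) :=
        Finset.le_sum_of_subadditive _ ENNReal.ofReal_zero.le (fun _ _ => ENNReal.ofReal_add_le) _ _
      refine hsub.trans (Finset.sum_le_sum fun i _ => ?_)
      refine (ofReal_integral_le_lintegral
        ((L2.integrable_inner (𝕜 := ℝ) (x i) (p i)).congr (hxp x i))).trans (le_of_eq ?_)
      refine lintegral_congr_ae ?_
      filter_upwards [hq i] with s hs
      rw [mul_comm, ENNReal.ofReal_mul hs.1]
      rfl)
  obtain ⟨a, ham, ha0, ha1, hya⟩ := exists_measurable_of_mem_allocationSet hyQ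
  refine ⟨a, ham, ha0, ha1, fun i => ?_⟩
  have haI : Integrable (a i) P :=
    memLp_one_iff_integrable.1 (memLp_of_measurable_of_mem_Icc (ham i)
      (Eventually.of_forall fun t => ⟨ha0 i t,
        (Finset.single_le_sum (fun k _ => ha0 k t) (Finset.mem_univ i)).trans (ha1 t)⟩) 1)
  have hmp := measurePreserving_update μ i
  refine (hqI i).ae_eq_of_forall_setIntegral_eq _ _
    (hmp.integrable_comp_of_integrable haI).integral_prod_left fun A hA _ => ?_
  -- Testing with the indicator of `A` for bidder `i` and zero for the others isolates the integral
  -- of `q i` over `A`; these integrals determine `q i` almost everywhere.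
  set g := indicatorConstLp 2 hA (measure_ne_top (μ i) A) (1 : ℝ)
  have hg : g =ᵐ[μ i] A.indicator fun _ => (1 : ℝ) := indicatorConstLp_coeFn
  set x : PiLp 2 fun i => Lp ℝ 2 (μ i) := WithLp.toLp 2 (Pi.single i g) with hx
  have hxi : x i = g := by simp [hx]
  have hxk : ∀ k, k ≠ i → x k = 0 := fun k hk => by simp [hx, hk]
  have key := hy x
  rw [PiLp.inner_apply, PiLp.inner_apply, Finset.sum_eq_single i _ (by simp),
    Finset.sum_eq_single i _ (by simp)] at key
  rotate_left
  · intro k _ hk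
    rw [hxk k hk, inner_zero_left]
  · intro k _ hk
    rw [liftProfile_apply, hxk k hk, map_zero, inner_zero_left]
  have hR : inner ℝ (x i) (p i) = ∫ s in A, q i s ∂μ i := by
    rw [hxi, L2.inner_indicatorConstLp_one]
    exact integral_congr_ae (ae_restrict_of_ae (hpq i))
  have hB : MeasurableSet {t : Fin n → ℝ | t i ∈ A} := measurable_pi_apply i hA
  have hL : inner ℝ (liftProfile μ x i) (y i) =
      ∫ t, {t : Fin n → ℝ | t i ∈ A}.indicator (a i) t ∂P := by
    rw [L2.inner_def]
    refine integral_congr_ae ?_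
    filter_upwards [coeFn_liftProfile μ x i, hya i,
      (measurePreserving_eval μ i).quasiMeasurePreserving.ae_eq_comp hg] with t h1 h2 h3
    rw [h1, h2, hxi, Real.inner_apply]
    simp only [Function.comp_apply, Function.eval] at h3
    rw [h3]
    by_cases ht : t i ∈ A
    · simp [Set.indicator, ht]
    · simp [Set.indicator, ht]
  rw [← hR, ← key, hL, integral_pi_eq_integral_update μ i (haI.indicator hB),
    ← integral_indicator hA]
  refine integral_congr_ae (Eventually.of_forall fun s => ?_)
  by_cases hs : s ∈ A
  · simp [Set.indicator, hs, P]
  · simp [Set.indicator, hs]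

end Existence

/-! ### Repair at exceptional types -/

section NullTypes

variable {n : ℕ} (μ : Fin n → Measure ℝ) [∀ i, IsProbabilityMeasure (μ i)]

/-- An allocation with almost surely correct interim rule can be modified on a null set of
profiles so that its interim rule is correct at every type. -/
theorem exists_allocation_of_ae_eq {q : Fin n → ℝ → ℝ} (hqm : ∀ i, Measurable (q i)) {D : Set ℝ}
    (hq : ∀ i, ∀ s ∈ D, q i s ∈ Set.Icc (0 : ℝ) 1)
    {a : Fin n → (Fin n → ℝ) → ℝ} (ham : ∀ i, Measurable (a i)) (ha0 : ∀ i t, 0 ≤ a i t)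
    (ha1 : ∀ t, ∑ i, a i t ≤ 1)
    (hae : ∀ i, ∀ᵐ s ∂μ i, q i s = ∫ t, a i (Function.update t i s) ∂Measure.pi μ) :
    ∃ a' : Fin n → (Fin n → ℝ) → ℝ, (∀ i, Measurable (a' i)) ∧
      (∀ t, (∀ i, t i ∈ D) → (∀ i, 0 ≤ a' i t) ∧ ∑ i, a' i t ≤ 1) ∧
      ∀ i s, q i s = ∫ t, a' i (Function.update t i s) ∂Measure.pi μ := by
  have hN : ∀ i, ∃ N, {s | q i s ≠ ∫ t, a i (Function.update t i s) ∂Measure.pi μ} ⊆ N ∧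
      MeasurableSet N ∧ μ i N = 0 := fun i =>
    exists_measurable_superset_of_null (ae_iff.1 (hae i))
  choose N hNsub hNm hN0 using hN
  have hmem : ∀ k, MeasurableSet {t : Fin n → ℝ | t k ∈ N k} := fun k =>
    measurable_pi_apply k (hNm k)
  -- Keep `a` when no type is exceptional. When exactly one is, that bidder alone gets the item,
  -- with probability `q i (t i)`; when several are, nobody does. The sets `B i` are disjoint, so
  -- feasibility holds. Given an exceptional `s`, the other types are almost surely ordinary, so the
  -- interim value is `q i s`.
  set G : Set (Fin n → ℝ) := {t | ∀ k, t k ∉ N k}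
  set B : Fin n → Set (Fin n → ℝ) := fun i => {t | t i ∈ N i ∧ ∀ k, k ≠ i → t k ∉ N k}
  have hG : MeasurableSet G := by
    have : G = ⋂ k, {t | t k ∈ N k}ᶜ := by ext; simp [G]
    rw [this]
    exact MeasurableSet.iInter fun k => (hmem k).compl
  have hB : ∀ i, MeasurableSet (B i) := by
    intro i
    have : B i = {t | t i ∈ N i} ∩ ⋂ k, ⋂ _ : k ≠ i, {t | t k ∈ N k}ᶜ := by ext; simp [B]
    rw [this]
    exact (hmem i).inter (MeasurableSet.iInter fun k => MeasurableSet.iInter fun _ =>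
      (hmem k).compl)
  have hGae : ∀ᵐ t ∂Measure.pi μ, t ∈ G := by
    refine eventually_all.2 fun k => ?_
    exact (measurePreserving_eval μ k).quasiMeasurePreserving.ae
      (p := fun s => s ∉ N k) (measure_eq_zero_iff_ae_notMem.1 (hN0 k))
  refine ⟨fun i t => G.indicator (a i) t + (B i).indicator (fun t => q i (t i)) t, fun i => ?_,
    fun t ht => ⟨fun i => ?_, ?_⟩, fun i s => ?_⟩
  · exact ((ham i).indicator hG).add
      (((hqm i).comp (measurable_pi_apply i)).indicator (hB i))
  · exact add_nonneg (Set.indicator_nonneg (fun t _ => ha0 i t) t)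
      (Set.indicator_apply_nonneg fun _ => (hq i _ (ht i)).1)
  · by_cases hB' : ∃ i, t ∈ B i
    · obtain ⟨i, hi⟩ := hB'
      have hGt : t ∉ G := fun h => h i hi.1
      simp only [Set.indicator_of_notMem hGt, zero_add]
      rw [Finset.sum_eq_single i _ (by simp), Set.indicator_of_mem hi]
      · exact (hq i _ (ht i)).2
      · exact fun k _ hk => Set.indicator_of_notMem (fun h => hi.2 k hk h.1) _
    · push Not at hB'
      simp only [Set.indicator_of_notMem (hB' _), add_zero]
      by_cases hGt : t ∈ G
      · simpa [hGt] using ha1 t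
      · simp [hGt]
  · by_cases hs : s ∈ N i
    · have : (fun t => G.indicator (a i) (Function.update t i s) +
          (B i).indicator (fun t => q i (t i)) (Function.update t i s)) =ᵐ[Measure.pi μ]
          fun _ => q i s := by
        filter_upwards [hGae] with t ht
        have h1 : Function.update t i s ∉ G := fun h => h i (by simpa using hs)
        have h2 : Function.update t i s ∈ B i := ⟨by simpa using hs, fun k hk => by
          simpa [hk] using ht k⟩
        rw [Set.indicator_of_notMem h1, Set.indicator_of_mem h2]
        simp
      rw [integral_congr_ae this]
      simp
    · have hqs : q i s = ∫ t, a i (Function.update t i s) ∂Measure.pi μ := by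
        by_contra h
        exact hs (hNsub i h)
      rw [hqs]
      refine integral_congr_ae ?_
      filter_upwards [hGae] with t ht
      have h1 : Function.update t i s ∈ G := by
        intro k
        rcases eq_or_ne k i with rfl | hk
        · simpa using hs
        · simpa [hk] using ht k
      have h2 : Function.update t i s ∉ B i := fun h => h1 i h.1
      rw [Set.indicator_of_mem h1, Set.indicator_of_notMem h2, add_zero]

end NullTypes

/-! ### Translation between densities and type laws -/

section TypeLaw

variable {b : ℝ} {f : ℝ → ℝ}

theorem ae_typeLaw_mem_Icc (b : ℝ) (f : ℝ → ℝ) : ∀ᵐ s ∂typeLaw b f, s ∈ Set.Icc 0 b :=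
  (withDensity_absolutelyContinuous _ _).ae_le (ae_restrict_mem measurableSet_Icc)

theorem IsTypeDensity.integrableOn (hf : IsTypeDensity b f) : IntegrableOn f (Set.Icc 0 b) := by
  by_contra h
  have := hf.integral_eq_one
  rw [integral_undef h] at this
  exact zero_ne_one this

theorem IsTypeDensity.isProbabilityMeasure (hf : IsTypeDensity b f) :
    IsProbabilityMeasure (typeLaw b f) := by
  constructor
  rw [typeLaw, withDensity_apply _ MeasurableSet.univ, Measure.restrict_univ,
    ← ofReal_integral_eq_lintegral_ofReal hf.integrableOn, hf.integral_eq_one, ENNReal.ofReal_one]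
  exact (ae_restrict_iff' measurableSet_Icc).2 (Eventually.of_forall hf.nonneg)

theorem IsTypeDensity.lintegral_mul (hf : IsTypeDensity b f) {q x : ℝ → ℝ} (hqm : Measurable q)
    (hq : ∀ s ∈ Set.Icc 0 b, 0 ≤ q s) (hx : Measurable x) :
    ∫⁻ t in Set.Icc 0 b, ENNReal.ofReal (q t * f t * x t) =
      ∫⁻ s, ENNReal.ofReal (q s) * (x s).toNNReal ∂typeLaw b f := by
  rw [typeLaw, lintegral_withDensity_eq_lintegral_mul _ hf.measurable.ennreal_ofReal
    (g := fun s => ENNReal.ofReal (q s) * (x s).toNNReal) (hqm.ennreal_ofReal.mul hx.real_toNNReal.coe_nnreal_ennreal)]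
  refine setLIntegral_congr_fun measurableSet_Icc fun s hs => ?_
  rw [ENNReal.ofReal_mul (mul_nonneg (hq s hs) (hf.nonneg s hs)), ENNReal.ofReal_mul (hq s hs),
    mul_comm (ENNReal.ofReal (q s)), mul_assoc]
  rfl

theorem IsTypeDensity.ofReal_setIntegral_mul (hf : IsTypeDensity b f) {q : ℝ → ℝ}
    (hqm : Measurable q) (hq : ∀ s ∈ Set.Icc 0 b, q s ∈ Set.Icc (0 : ℝ) 1) {S : Set ℝ}
    (hS : MeasurableSet S) (hSb : S ⊆ Set.Icc 0 b) :
    ENNReal.ofReal (∫ t in S, q t * f t) = ∫⁻ s in S, ENNReal.ofReal (q s) ∂typeLaw b f := by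
  have hae : ∀ᵐ t ∂(volume.restrict S), t ∈ Set.Icc 0 b :=
    (ae_restrict_mem hS).mono fun t ht => hSb ht
  rw [ofReal_integral_eq_lintegral_ofReal]
  · rw [typeLaw, restrict_withDensity hS, Measure.restrict_restrict hS,
      Set.inter_eq_left.2 hSb, lintegral_withDensity_eq_lintegral_mul _
      hf.measurable.ennreal_ofReal hqm.ennreal_ofReal]
    refine lintegral_congr_ae (hae.mono fun t ht => ?_)
    show ENNReal.ofReal (q t * f t) = ENNReal.ofReal (f t) * ENNReal.ofReal (q t)
    rw [mul_comm (q t), ENNReal.ofReal_mul (hf.nonneg t ht)]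
  · refine (hf.integrableOn.mono_set hSb).bdd_mul (c := 1) hqm.aestronglyMeasurable
      (hae.mono fun t ht => ?_)
    rw [Real.norm_of_nonneg (hq t ht).1]
    exact (hq t ht).2
  · exact hae.mono fun t ht => mul_nonneg (hq t ht).1 (hf.nonneg t ht)

theorem IsTypeDensity.setIntegral_eq (hf : IsTypeDensity b f) {S : Set ℝ}
    (hS : MeasurableSet S) (hSb : S ⊆ Set.Icc 0 b) :
    ∫ t in S, f t = (typeLaw b f S).toReal := by
  have h := hf.ofReal_setIntegral_mul (q := fun _ => 1) measurable_const
    (fun _ _ => ⟨zero_le_one, le_rfl⟩) hS hSb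
  simp only [one_mul, ENNReal.ofReal_one, setLIntegral_one] at h
  rw [← h, ENNReal.toReal_ofReal]
  exact setIntegral_nonneg hS fun t ht => hf.nonneg t (hSb ht)

end TypeLaw

/-! ### Border's inequality against the surplus inequality -/

section Inequalities

variable {n : ℕ} {b : ℝ} {f q : Fin n → ℝ → ℝ}

theorem one_sub_prod_nonneg {μ : Fin n → Measure ℝ} [∀ i, IsProbabilityMeasure (μ i)]
    (S : Fin n → Set ℝ) : 0 ≤ 1 - ∏ i, (1 - (μ i (S i)).toReal) := by
  have h : ∀ i, (μ i (S i)).toReal ≤ 1 := fun i =>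
    ENNReal.toReal_le_of_le_ofReal zero_le_one (by simpa using prob_le_one)
  exact sub_nonneg.2 (Finset.prod_le_one (fun i _ => sub_nonneg.2 (h i))
    fun i _ => sub_le_self _ ENNReal.toReal_nonneg)

/-- Both sides of Border's inequality are nonnegative, so nothing is lost in passing to `ℝ≥0∞`. -/
theorem borderInequality_iff (hf : ∀ i, IsTypeDensity b (f i)) (hqm : ∀ i, Measurable (q i))
    (hq : ∀ i, ∀ s ∈ Set.Icc 0 b, q i s ∈ Set.Icc (0 : ℝ) 1) {S : Fin n → Set ℝ}
    (hS : ∀ i, MeasurableSet (S i) ∧ S i ⊆ Set.Icc 0 b) :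
    BorderInequality f q S ↔
      ∑ i, ∫⁻ s in S i, ENNReal.ofReal (q i s) ∂typeLaw b (f i) ≤
        ENNReal.ofReal (1 - ∏ i, (1 - (typeLaw b (f i) (S i)).toReal)) := by
  have := fun i => (hf i).isProbabilityMeasure
  simp only [BorderInequality, fun i => (hf i).setIntegral_eq (hS i).1 (hS i).2]
  simp only [← fun i => (hf i).ofReal_setIntegral_mul (hqm i) (hq i) (hS i).1 (hS i).2]
  rw [← ENNReal.ofReal_sum_of_nonneg, ENNReal.ofReal_le_ofReal_iff (one_sub_prod_nonneg S)]
  exact fun i _ => setIntegral_nonneg (hS i).1 fun t ht =>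
    mul_nonneg (hq i t ((hS i).2 ht)).1 ((hf i).nonneg t ((hS i).2 ht))

theorem surplusInequality_iff (hf : ∀ i, IsTypeDensity b (f i)) (hqm : ∀ i, Measurable (q i))
    (hq : ∀ i, ∀ s ∈ Set.Icc 0 b, q i s ∈ Set.Icc (0 : ℝ) 1) {x : Fin n → ℝ → ℝ}
    (hx : ∀ i, Measurable (x i)) :
    SurplusInequality b f q x ↔
      ∑ i, ∫⁻ s, ENNReal.ofReal (q i s) * (x i s).toNNReal ∂typeLaw b (f i) ≤
        ∫⁻ v in Set.Ioi (0 : ℝ),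
          ENNReal.ofReal (1 - ∏ i, (1 - (typeLaw b (f i) {s | v ≤ (x i s).toNNReal}).toReal)) := by
  rw [SurplusInequality]
  simp only [fun i => (hf i).lintegral_mul (hqm i) (fun s hs => (hq i s hs).1) (hx i)]
  refine iff_of_eq (congrArg _ (setLIntegral_congr_fun measurableSet_Ioi fun v hv => ?_))
  have hv : (0 : ℝ) < v := hv
  have h : ∀ i, ∫ t in {t | t ∈ Set.Icc 0 b ∧ v ≤ x i t}, f i t =
      (typeLaw b (f i) {s | v ≤ (x i s).toNNReal}).toReal := by
    intro i
    have hm : MeasurableSet {t | t ∈ Set.Icc 0 b ∧ v ≤ x i t} :=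
      measurableSet_Icc.inter (measurableSet_le measurable_const (hx i))
    rw [(hf i).setIntegral_eq hm fun t ht => ht.1]
    congr 1
    refine measure_congr ?_
    filter_upwards [ae_typeLaw_mem_Icc b (f i)] with s hs
    refine propext ⟨fun h => h.2.trans (Real.le_coe_toNNReal _), fun h => ⟨hs, ?_⟩⟩
    -- Truncation at zero does not alter level sets at heights `v > 0`.
    rcases le_max_iff.1 (show v ≤ max (x i s) 0 from h) with h | h
    · exact h
    · exact absurd hv (not_lt.2 h)
  simp only [h]

/-- For indicator functions the surplus inequality is Border's inequality. -/
theorem surplusInequality_indicator_iff (hf : ∀ i, IsTypeDensity b (f i))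
    (hqm : ∀ i, Measurable (q i)) (hq : ∀ i, ∀ s ∈ Set.Icc 0 b, q i s ∈ Set.Icc (0 : ℝ) 1)
    {S : Fin n → Set ℝ} (hS : ∀ i, MeasurableSet (S i) ∧ S i ⊆ Set.Icc 0 b) :
    SurplusInequality b f q (fun i => (S i).indicator fun _ => (1 : ℝ)) ↔
      BorderInequality f q S := by
  rw [surplusInequality_iff hf hqm hq fun i => measurable_const.indicator (hS i).1,
    borderInequality_iff hf hqm hq hS]
  have hL : ∀ i, ∫⁻ s, ENNReal.ofReal (q i s) *
      ((S i).indicator (fun _ => (1 : ℝ)) s).toNNReal ∂typeLaw b (f i) =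
      ∫⁻ s in S i, ENNReal.ofReal (q i s) ∂typeLaw b (f i) := by
    intro i
    rw [← lintegral_indicator (hS i).1]
    refine lintegral_congr fun s => ?_
    by_cases hs : s ∈ S i <;> simp [hs]
  have hR : ∫⁻ v in Set.Ioi (0 : ℝ), ENNReal.ofReal (1 - ∏ i, (1 - (typeLaw b (f i)
      {s | v ≤ ((S i).indicator (fun _ => (1 : ℝ)) s).toNNReal}).toReal)) =
      ENNReal.ofReal (1 - ∏ i, (1 - (typeLaw b (f i) (S i)).toReal)) := by
    -- The level sets are `S i` for `0 < v ≤ 1` and empty for `v > 1`, so the integrand is constant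
    -- on an interval of length one and zero beyond it.
    have : ∀ v ∈ Set.Ioi (0 : ℝ), ENNReal.ofReal (1 - ∏ i, (1 - (typeLaw b (f i)
        {s | v ≤ ((S i).indicator (fun _ => (1 : ℝ)) s).toNNReal}).toReal)) =
        (Set.Iic (1 : ℝ)).indicator (fun _ =>
          ENNReal.ofReal (1 - ∏ i, (1 - (typeLaw b (f i) (S i)).toReal))) v := by
      intro v hv
      have hv : (0 : ℝ) < v := hv
      by_cases hv1 : v ≤ 1
      · rw [Set.indicator_of_mem (show v ∈ Set.Iic (1 : ℝ) from hv1)]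
        have : ∀ i, {s | v ≤ ((S i).indicator (fun _ => (1 : ℝ)) s).toNNReal} = S i := by
          intro i
          ext s
          by_cases hs : s ∈ S i <;> simp [hs, hv1, hv]
        simp only [this]
      · rw [Set.indicator_of_notMem (show v ∉ Set.Iic (1 : ℝ) from hv1)]
        have : ∀ i, {s | v ≤ ((S i).indicator (fun _ => (1 : ℝ)) s).toNNReal} = ∅ := by
          intro i
          ext s
          by_cases hs : s ∈ S i <;> simp [hs, not_le.1 hv1, hv]
        simp only [this]
        simp
    rw [setLIntegral_congr_fun measurableSet_Ioi this, lintegral_indicator measurableSet_Iic,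
      Measure.restrict_restrict measurableSet_Iic, setLIntegral_const, Set.inter_comm,
      Set.Ioi_inter_Iic, Real.volume_Ioc]
    simp
  simp only [hL, hR]

/-- Border's inequalities imply the surplus inequality, by integration over the level sets. -/
theorem lintegral_le_of_borderInequality (hf : ∀ i, IsTypeDensity b (f i))
    (hqm : ∀ i, Measurable (q i)) (hq : ∀ i, ∀ s ∈ Set.Icc 0 b, q i s ∈ Set.Icc (0 : ℝ) 1)
    (h : ∀ S : Fin n → Set ℝ, (∀ i, MeasurableSet (S i) ∧ S i ⊆ Set.Icc 0 b) →
      BorderInequality f q S) {x : Fin n → ℝ → ℝ≥0} (hx : ∀ i, Measurable (x i)) :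
    ∑ i, ∫⁻ s, ENNReal.ofReal (q i s) * x i s ∂typeLaw b (f i) ≤
      ∫⁻ v in Set.Ioi (0 : ℝ),
        ENNReal.ofReal (1 - ∏ i, (1 - (typeLaw b (f i) {s | v ≤ x i s}).toReal)) := by
  -- Weighting the type law by `q i` makes the left-hand side a layer-cake integral too; Border's
  -- inequality for the level sets then compares the integrands at each `v`.
  set ν : Fin n → Measure ℝ := fun i =>
    (typeLaw b (f i)).withDensity fun s => ENNReal.ofReal (q i s) with hν
  have hms : ∀ i (v : ℝ), MeasurableSet {s | v ≤ (x i s : ℝ)} := fun i v =>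
    measurableSet_le measurable_const (hx i).coe_nnreal_real
  have hL : ∀ i, ∫⁻ s, ENNReal.ofReal (q i s) * x i s ∂typeLaw b (f i) =
      ∫⁻ v in Set.Ioi (0 : ℝ), ν i {s | v ≤ (x i s : ℝ)} := by
    intro i
    rw [← lintegral_eq_lintegral_meas_le (ν i) (Eventually.of_forall fun s => NNReal.coe_nonneg _)
      (hx i).coe_nnreal_real.aemeasurable]
    simp only [ENNReal.ofReal_coe_nnreal]
    rw [hν, lintegral_withDensity_eq_lintegral_mul _ (hqm i).ennreal_ofReal
      (hx i).coe_nnreal_ennreal]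
    rfl
  have hmeas : ∀ i, Measurable fun v : ℝ => ν i {s | v ≤ (x i s : ℝ)} := fun i =>
    Antitone.measurable fun v w hvw => measure_mono fun s hs => hvw.trans hs
  simp only [hL]
  rw [← lintegral_finsetSum _ fun i _ => hmeas i]
  refine lintegral_mono fun v => ?_
  have hS : ∀ i, MeasurableSet ({s | v ≤ (x i s : ℝ)} ∩ Set.Icc 0 b) ∧
      {s | v ≤ (x i s : ℝ)} ∩ Set.Icc 0 b ⊆ Set.Icc 0 b := fun i =>
    ⟨(hms i v).inter measurableSet_Icc, Set.inter_subset_right⟩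
  have hB := (borderInequality_iff hf hqm hq hS).1 (h _ hS)
  have hae : ∀ i, ({s | v ≤ (x i s : ℝ)} ∩ Set.Icc 0 b : Set ℝ) =ᵐ[typeLaw b (f i)]
      {s | v ≤ (x i s : ℝ)} := by
    intro i
    filter_upwards [ae_typeLaw_mem_Icc b (f i)] with s hs
    exact propext ⟨fun h => h.1, fun h => ⟨h, hs⟩⟩
  simp only [fun i => setLIntegral_congr (f := fun s => ENNReal.ofReal (q i s)) (hae i),
    fun i => measure_congr (hae i)] at hB
  simpa only [hν, withDensity_apply _ (hms _ v)] using hB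

end Inequalities

/-! ### Necessity and sufficiency for mechanisms -/

section Implementation

variable {m n : ℕ} {b : ℝ} {f : Fin n → ℝ → ℝ} {q : Fin m → Fin n → ℝ → ℝ}

/-- The expected virtual surplus of a feasible mechanism is at most the expected highest virtual
value. -/
theorem Implementable.lintegral_le (hf : ∀ i, IsTypeDensity b (f i))
    (h : Implementable b f q) (j : Fin m) {x : Fin n → ℝ → ℝ≥0}
    (hx : ∀ i, Measurable (x i)) :
    ∑ i, ∫⁻ s, ENNReal.ofReal (q j i s) * x i s ∂typeLaw b (f i) ≤
      ∫⁻ t, ((Finset.univ.sup fun i => x i (t i) : ℝ≥0) : ℝ≥0∞)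
        ∂Measure.pi fun i => typeLaw b (f i) := by
  have := fun i => (hf i).isProbabilityMeasure
  set μ : Fin n → Measure ℝ := fun i => typeLaw b (f i)
  have hprob : ∀ i, IsProbabilityMeasure (μ i) := this
  obtain ⟨M, hM, hMq⟩ := h
  have hae : ∀ᵐ t ∂Measure.pi μ, ∀ i, t i ∈ Set.Icc 0 b := eventually_all.2 fun i =>
    (measurePreserving_eval μ i).quasiMeasurePreserving.ae (ae_typeLaw_mem_Icc b (f i))
  have hmeas : ∀ i, Measurable fun t : Fin n → ℝ =>
      ENNReal.ofReal (M.alloc j i t) * x i (t i) := fun i =>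
    (M.measurable_alloc j i).ennreal_ofReal.mul
      ((hx i).comp (measurable_pi_apply i)).coe_nnreal_ennreal
  -- Conditioning on the type `s` of bidder `i` fixes the factor `x i s` and averages the allocation
  -- to its interim value.
  have hstep : ∀ i, ∫⁻ s, ENNReal.ofReal (q j i s) * x i s ∂μ i =
      ∫⁻ t, ENNReal.ofReal (M.alloc j i t) * x i (t i) ∂Measure.pi μ := by
    intro i
    rw [lintegral_pi_eq_lintegral_update μ i (hmeas i)]
    refine lintegral_congr_ae ((ae_typeLaw_mem_Icc b (f i)).mono fun s hs => ?_)
    have hup : Measurable fun t : Fin n → ℝ => M.alloc j i (Function.update t i s) :=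
      (M.measurable_alloc j i).comp
        ((measurable_update_pair i).comp (measurable_const.prodMk measurable_id))
    have h01 : ∀ᵐ t ∂Measure.pi μ,
        M.alloc j i (Function.update t i s) ∈ Set.Icc (0 : ℝ) 1 := by
      filter_upwards [hae] with t ht
      have hu : ∀ k, Function.update t i s k ∈ Set.Icc 0 b := by
        intro k
        rcases eq_or_ne k i with rfl | hk
        · simpa using hs
        · simpa [hk] using ht k
      obtain ⟨h0, h1⟩ := hM _ hu j
      exact ⟨h0 i, (Finset.single_le_sum (fun k _ => h0 k) (Finset.mem_univ i)).trans h1⟩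
    simp only [Function.update_self]
    rw [lintegral_mul_const _ hup.ennreal_ofReal, hMq j i s hs, DirectMechanism.interim,
      ofReal_integral_eq_lintegral_ofReal
      (memLp_one_iff_integrable.1 (memLp_of_measurable_of_mem_Icc hup h01 1))
      (h01.mono fun t ht => ht.1)]
  refine (Finset.sum_congr rfl fun i _ => hstep i).trans_le ?_
  rw [← lintegral_finsetSum _ fun i _ => hmeas i]
  refine lintegral_mono_ae (hae.mono fun t ht => ?_)
  obtain ⟨h0, h1⟩ := hM t ht j
  calc ∑ i, ENNReal.ofReal (M.alloc j i t) * (x i (t i) : ℝ≥0∞)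
      ≤ ∑ i, ENNReal.ofReal (M.alloc j i t) *
          ((Finset.univ.sup fun i => x i (t i) : ℝ≥0) : ℝ≥0∞) := by
        refine Finset.sum_le_sum fun i _ => mul_le_mul_right ?_ _
        exact ENNReal.coe_le_coe.2 (Finset.le_sup (f := fun i => x i (t i)) (Finset.mem_univ i))
    _ = ENNReal.ofReal (∑ i, M.alloc j i t) *
          ((Finset.univ.sup fun i => x i (t i) : ℝ≥0) : ℝ≥0∞) := by
        rw [ENNReal.ofReal_sum_of_nonneg fun i _ => h0 i, Finset.sum_mul]
    _ ≤ _ := mul_le_of_le_one_left zero_le (ENNReal.ofReal_le_one.2 h1)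

/-- Border's inequalities are sufficient for implementability. -/
theorem implementable_of_borderInequality (hf : ∀ i, IsTypeDensity b (f i))
    (hq : IsInterimRule b q)
    (h : ∀ S : Fin n → Set ℝ, (∀ i, MeasurableSet (S i) ∧ S i ⊆ Set.Icc 0 b) →
      ∀ j, BorderInequality f (q j) S) : Implementable b f q := by
  have := fun i => (hf i).isProbabilityMeasure
  have key : ∀ j, ∃ a : Fin n → (Fin n → ℝ) → ℝ, (∀ i, Measurable (a i)) ∧
      (∀ t, (∀ i, t i ∈ Set.Icc 0 b) → (∀ i, 0 ≤ a i t) ∧ ∑ i, a i t ≤ 1) ∧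
      ∀ i s, q j i s = ∫ t, a i (Function.update t i s) ∂Measure.pi fun i => typeLaw b (f i) := by
    intro j
    obtain ⟨a, ham, ha0, ha1, hae⟩ := exists_allocation_of_surplus (fun i => typeLaw b (f i))
      (hq.measurable j) (fun i => (ae_typeLaw_mem_Icc b (f i)).mono (hq.mem_Icc j i))
      fun x hx => by
        rw [lintegral_sup_eq_lintegral_prod _ hx]
        exact lintegral_le_of_borderInequality hf (hq.measurable j) (hq.mem_Icc j)
          (fun S hS => h S hS j) hx
    exact exists_allocation_of_ae_eq _ (hq.measurable j) (hq.mem_Icc j) ham ha0 ha1 hae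
  choose a ham hfeas hint using key
  -- Feasibility does not link different items or restrict payments, so the allocations are chosen
  -- separately and payments set to zero.
  exact ⟨⟨a, fun _ _ => 0, ham, fun _ => measurable_const⟩, fun t ht j => hfeas j t ht,
    fun j i s _ => hint j i s⟩

theorem Implementable.surplusInequality (hf : ∀ i, IsTypeDensity b (f i))
    (h : Implementable b f q) (hq : IsInterimRule b q) (j : Fin m) {x : Fin n → ℝ → ℝ}
    (hx : ∀ i, IsVirtualValue b (x i)) : SurplusInequality b f (q j) x := by
  have := fun i => (hf i).isProbabilityMeasure
  rw [surplusInequality_iff hf (hq.measurable j) (hq.mem_Icc j) fun i => (hx i).measurable,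
    ← lintegral_sup_eq_lintegral_prod _ fun i => (hx i).measurable.real_toNNReal]
  exact h.lintegral_le hf j fun i => (hx i).measurable.real_toNNReal

end Implementation

end Auction

theorem mainTheorem2 {m n : ℕ} (b : ℝ) (hb : 0 < b)
    (f : Fin n → ℝ → ℝ) (hf : ∀ i, Auction.IsTypeDensity b (f i))
    (q : Fin m → Fin n → ℝ → ℝ) (hq : Auction.IsInterimRule b q) :
    -- the generalized Border theorem
    (Auction.Implementable b f q ↔
      ∀ x : Fin m → Fin n → ℝ → ℝ, (∀ j i, Auction.IsVirtualValue b (x j i)) →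
        ∀ j, Auction.SurplusInequality b f (q j) (x j)) ∧
    -- for indicator functions the surplus inequality is Border's inequality
    (∀ S : Fin n → Set ℝ, (∀ i, MeasurableSet (S i) ∧ S i ⊆ Set.Icc 0 b) →
      ∀ j, (Auction.SurplusInequality b f (q j) (fun i => (S i).indicator (fun _ => (1 : ℝ))) ↔
        Auction.BorderInequality f (q j) S)) ∧
    -- Border's theorem
    (Auction.Implementable b f q ↔
      ∀ S : Fin n → Set ℝ, (∀ i, MeasurableSet (S i) ∧ S i ⊆ Set.Icc 0 b) →
        ∀ j, Auction.BorderInequality f (q j) S) := by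
  have hind : ∀ S : Fin n → Set ℝ, (∀ i, MeasurableSet (S i) ∧ S i ⊆ Set.Icc 0 b) →
      ∀ j, (Auction.SurplusInequality b f (q j) (fun i => (S i).indicator (fun _ => (1 : ℝ))) ↔
        Auction.BorderInequality f (q j) S) := fun S hS j =>
    Auction.surplusInequality_indicator_iff hf (hq.measurable j) (hq.mem_Icc j) hS
  have hval : ∀ S : Fin n → Set ℝ, (∀ i, MeasurableSet (S i) ∧ S i ⊆ Set.Icc 0 b) →
      ∀ i, Auction.IsVirtualValue b ((S i).indicator fun _ => (1 : ℝ)) := fun S hS i =>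
    ⟨measurable_const.indicator (hS i).1,
      fun t _ => Set.indicator_nonneg (fun _ _ => zero_le_one) t⟩
  -- Both equivalences come from one cycle: implementable, surplus inequalities, Border's
  -- inequalities via indicators, implementable.
  refine ⟨⟨fun h x hx j => h.surplusInequality hf hq j (hx j), fun h => ?_⟩, hind,
    fun h S hS j => (hind S hS j).1 (h.surplusInequality hf hq j (hval S hS)),
    Auction.implementable_of_borderInequality hf hq⟩
  exact Auction.implementable_of_borderInequality hf hq fun S hS j =>
    (hind S hS j).1 (h (fun _ i => (S i).indicator fun _ => (1 : ℝ)) (fun _ => hval S hS) j)
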